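/- For $x\in\mathbb{R}^n$ and $1<p<\infty$ let $\|x\|_p=(\sum_i|x_i|^p)^{1/p}$, and let $J_p(x)=\|x\|_p^{1-p}\,\Phi_p(x)$ with $\Phi_p(x)_i=|x_i|^{p-2}x_i$ for $x\ne 0$, $J_p(0)=0$ (the gradient of $\|\cdot\|_p$ at $x\neq 0$). For nonnegative vectors write $x\le y$ entrywise, and $x\sim y$ if $cy\le x\le Cy$ for some $c,C>0$. Let $M(x/y)=\inf\{C>0: x\le Cy\}$. Hilbert's projective metric is $d_H(x,y)=\ln\big(M(x/y)M(y/x)\big)$ if $x\sim y$ and $x,y$ are not both $0$, $d_H(0,0)=0$, and $d_H(x,y)=\infty$ otherwise. For a map $F:\mathbb{R}^n_+\to\mathbb{R}^m_+$ the Birkhoff contraction ratio is $$\kappa_H(F)=\inf\{C>0:\ d_H(F(x),F(y))\le C\,d_H(x,y)\ \text{ for all } x,y\in\mathbb{R}^n_+ \text{ with } x\sim y\}\in[0,\infty].$$ Let $1<p,q<\infty$ and $q^*=q/(q-1)$. Let $n\geq 1$, let $A\in\mathbb{R}^{m\times n}$ have nonnegative entries, suppose that $A^TA$ is irreducible (for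 all $i,j$ some power $(A^TA)^k$, $k\ge1$, has a positive $(i,j)$ entry), and put $$\tau=\kappa_H(A)\,\kappa_H(A^T)\,\frac{p-1}{q-1}.$$ If $\tau<1$, then the maximum $\|A\|_{q\to p}=\max_{x\ne0}\|Ax\|_p/\|x\|_q$ is attained and the nonlinear power method converges to it: there is an entrywise positive vector $x^+$ with $\|x^+\|_q=1$ and $\|Ax^+\|_p=\|A\|_{q\to p}$ such that, for every entrywise positive starting vector $x$, the sequence $$x_0=\frac{x}{\|x\|_q},\qquad x_{k+1}=J_{q^*}\big(A^TJ_p(Ax_k)\big),\quad k=0,1,2,\dots,$$ satisfies $x_k\to x^+$ and $\|Ax_k\|_p\to\|A\|_{q\to p}$ as $k\to\infty$. No relation between $p$ and $q$ is assumed, and cases with $p>q$ do occur: for all $1<q<p<\infty$ there is an invertible $2\times2$ matrix $A$ with positive entries, so that $A^TA$ is irreducible, for which $\tau<1$. -/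

import Mathlib

noncomputable section

namespace PowerMethod

/-- The `ℓ^p` norm of a real vector, for a real exponent `p`. -/
def vecNorm {n : ℕ} (p : ℝ) (x : Fin n → ℝ) : ℝ :=
  ‖WithLp.toLp (ENNReal.ofReal p) x‖

/-- Sanity check: the explicit formula for the `ℓ^p` norm. -/
theorem vecNorm_eq {n : ℕ} {p : ℝ} (hp : 1 < p) (x : Fin n → ℝ) :
    vecNorm p x = (∑ i, |x i| ^ p) ^ (1 / p) := by
  have h0 : 0 ≤ p := by linarith
  have h : (ENNReal.ofReal p).toReal = p := ENNReal.toReal_ofReal h0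
  unfold vecNorm
  rw [PiLp.norm_eq_sum (by rw [h]; linarith)]
  simp [h, Real.norm_eq_abs]

/-- The set of all quotients `‖Ax‖_p / ‖x‖_q` with `x ≠ 0`. -/
def normQuotients {m n : ℕ} (A : Matrix (Fin m) (Fin n) ℝ) (q p : ℝ) : Set ℝ :=
  {r | ∃ x : Fin n → ℝ, x ≠ 0 ∧ r = vecNorm p (A.mulVec x) / vecNorm q x}

/-- The matrix norm `‖A‖_{q → p}`. -/
def matNorm {m n : ℕ} (A : Matrix (Fin m) (Fin n) ℝ) (q p : ℝ) : ℝ :=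
  sSup (normQuotients A q p)

/-- Two vectors are comparable if `c y ≤ x ≤ C y` for some `c, C > 0`. -/
def Comparable {n : ℕ} (x y : Fin n → ℝ) : Prop :=
  ∃ c C : ℝ, 0 < c ∧ 0 < C ∧ c • y ≤ x ∧ x ≤ C • y

/-- `M(x/y) = inf {C > 0 : x ≤ C y}`. -/
def upperRatio {n : ℕ} (x y : Fin n → ℝ) : ℝ :=
  sInf {C : ℝ | 0 < C ∧ x ≤ C • y}

open Classical in
/-- Hilbert's projective metric on the nonnegative orthant, with values in `[0, ∞]`. -/
def hilbertDist {n : ℕ} (x y : Fin n → ℝ) : ENNReal :=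
  if x = 0 ∧ y = 0 then 0
  else if Comparable x y then ENNReal.ofReal (Real.log (upperRatio x y * upperRatio y x))
  else ⊤

/-- The Birkhoff contraction ratio in `[0, ∞]` of a map between nonnegative orthants: the infimum of
the finite `C > 0` with `d_H(F x, F y) ≤ C d_H(x, y)` for all comparable nonnegative `x`, `y`. -/
def birkhoffRatio {n m : ℕ} (F : (Fin n → ℝ) → (Fin m → ℝ)) : ENNReal :=
  sInf {C : ENNReal | 0 < C ∧ C ≠ ⊤ ∧ ∀ x y : Fin n → ℝ, 0 ≤ x → 0 ≤ y → Comparable x y →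
    hilbertDist (F x) (F y) ≤ C * hilbertDist x y}

/-- `τ = κ_H(A) κ_H(Aᵀ) (p - 1) / (q - 1)`. -/
def tau {m n : ℕ} (A : Matrix (Fin m) (Fin n) ℝ) (p q : ℝ) : ENNReal :=
  birkhoffRatio (fun x => A.mulVec x) * birkhoffRatio (fun y => A.transpose.mulVec y) *
    ENNReal.ofReal ((p - 1) / (q - 1))

/-- The map `J_p(x) = ‖x‖_p^{1-p} Φ_p(x)`, `Φ_p(x)_i = |x_i|^{p-2} x_i`. This is the gradient of the
`ℓ^p` norm at `x ≠ 0`, and `J_p(0) = 0`. -/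
def dualityMap {n : ℕ} (p : ℝ) (x : Fin n → ℝ) : Fin n → ℝ :=
  fun i => vecNorm p x ^ (1 - p) * (|x i| ^ (p - 2) * x i)

/-- One step of the nonlinear power method, `x ↦ J_{q*}(Aᵀ J_p(A x))` with `1/q + 1/q* = 1`. -/
def powerStep {m n : ℕ} (A : Matrix (Fin m) (Fin n) ℝ) (p q : ℝ) (x : Fin n → ℝ) : Fin n → ℝ :=
  dualityMap (Real.conjExponent q) (A.transpose.mulVec (dualityMap p (A.mulVec x)))

/-- The power sequence: the starting vector is scaled to `ℓ^q` norm one and then `powerStep` is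
iterated. -/
def powerSeq {m n : ℕ} (A : Matrix (Fin m) (Fin n) ℝ) (p q : ℝ) (x₀ : Fin n → ℝ) :
    ℕ → Fin n → ℝ
  | 0 => (vecNorm q x₀)⁻¹ • x₀
  | k + 1 => powerStep A p q (powerSeq A p q x₀ k)

end PowerMethod

end

/-!
For comparable vectors in the nonnegative orthant the Hilbert distance is `ln (C D)` with the optimal
scalars in `x ≤ C y`, `y ≤ D x` (`exists_hilbertDist_eq`), so it can be estimated by moving such
inequalities through a map. A nonnegative matrix preserves them, hence has Birkhoff ratio at most
one; the duality map `J_p` raises the scalars to the power `p - 1`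
(`comparable_and_hilbertDist_dualityMap_le`). Since `q* - 1 = 1 / (q - 1)`, one step of the power
method contracts the Hilbert metric by the factor `τ` (`hilbertDist_powerStep_le`).

A maximizer of `‖Ax‖_p` on the compact unit sphere of `ℓ^q` may be taken nonnegative. The equality
case of Hölder's inequality (`eq_dualityMap_of_vecNorm_le`), which is that of Young's inequality in
each coordinate, shows that it is a fixed point of the power method
(`powerStep_eq_self_of_maximizer`); this takes the place of differentiating the norms. At a
nonnegative fixed point the support is closed under the edges of the graph of `AᵀA`, so the
fixed point is entrywise positive. Every power sequence then approaches it at rate `τ ^ k` in the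
Hilbert metric, and on the unit sphere `d_H(x, y) = d` forces `e^{-d} y ≤ x ≤ e^d y`
(`le_exp_hilbertDist_smul`), which gives convergence of the entries.

For the second part, the matrix with diagonal entries `a > 1` and off-diagonal entries `1` has
Birkhoff ratio at most `a² - 1` (`birkhoffRatio_fin_two_le`), which is as small as desired.
-/

namespace PowerMethod

open Filter Topology

/-! ### Hilbert's projective metric -/

theorem Comparable.exists_le {n : ℕ} {x y : Fin n → ℝ} (h : Comparable x y) :
    ∃ C D : ℝ, 0 < C ∧ 0 < D ∧ x ≤ C • y ∧ y ≤ D • x := by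
  obtain ⟨c, C, hc, hC, h1, h2⟩ := h
  refine ⟨C, c⁻¹, hC, inv_pos.2 hc, h2, fun i => ?_⟩
  have := h1 i
  simp only [Pi.smul_apply, smul_eq_mul] at this ⊢
  rw [inv_mul_eq_div, le_div_iff₀ hc]
  linarith

theorem comparable_of_le {n : ℕ} {x y : Fin n → ℝ} {C D : ℝ} (hC : 0 < C) (hD : 0 < D)
    (h1 : x ≤ C • y) (h2 : y ≤ D • x) : Comparable x y := by
  refine ⟨D⁻¹, C, inv_pos.2 hD, hC, fun i => ?_, h1⟩
  have := h2 i
  simp only [Pi.smul_apply, smul_eq_mul] at this ⊢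
  rw [inv_mul_eq_div, div_le_iff₀ hD]
  linarith

theorem exists_le_smul_of_pos {n : ℕ} (x : Fin n → ℝ) {y : Fin n → ℝ} (hy : ∀ i, 0 < y i) :
    ∃ C : ℝ, 0 < C ∧ x ≤ C • y := by
  have h0 : ∀ i, 0 ≤ |x i| / y i := fun i => div_nonneg (abs_nonneg _) (hy i).le
  have hs : 0 ≤ ∑ i, |x i| / y i := Finset.sum_nonneg fun i _ => h0 i
  refine ⟨∑ i, |x i| / y i + 1, by linarith, fun i => ?_⟩
  have h1 : |x i| / y i ≤ ∑ i, |x i| / y i :=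
    Finset.single_le_sum (f := fun i => |x i| / y i) (fun i _ => h0 i) (Finset.mem_univ i)
  have h2 : |x i| / y i * y i = |x i| := div_mul_cancel₀ _ (hy i).ne'
  have h3 := mul_le_mul_of_nonneg_right h1 (hy i).le
  simp only [Pi.smul_apply, smul_eq_mul]
  nlinarith [le_abs_self (x i), hy i]

theorem comparable_of_pos {n : ℕ} {x y : Fin n → ℝ} (hx : ∀ i, 0 < x i) (hy : ∀ i, 0 < y i) :
    Comparable x y := by
  obtain ⟨C, hC, h1⟩ := exists_le_smul_of_pos x hy
  obtain ⟨D, hD, h2⟩ := exists_le_smul_of_pos y hx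
  exact comparable_of_le hC hD h1 h2

theorem upperRatio_nonneg {n : ℕ} (x y : Fin n → ℝ) : 0 ≤ upperRatio x y :=
  Real.sInf_nonneg fun _ h => h.1.le

theorem upperRatio_le {n : ℕ} {x y : Fin n → ℝ} {C : ℝ} (hC : 0 < C) (h : x ≤ C • y) :
    upperRatio x y ≤ C :=
  csInf_le ⟨0, fun _ h => h.1.le⟩ ⟨hC, h⟩

/-- The infimum defining `M(x/y)` is attained. -/
theorem le_upperRatio_smul {n : ℕ} {x y : Fin n → ℝ} (hy : 0 ≤ y) {C : ℝ} (hC : 0 < C)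
    (h : x ≤ C • y) : x ≤ upperRatio x y • y := by
  intro i
  rcases (hy i).eq_or_lt with h0 | h0
  · have h1 := h i
    simp only [Pi.smul_apply, smul_eq_mul, ← h0, Pi.zero_apply, mul_zero] at h1 ⊢
    exact h1
  · simp only [Pi.zero_apply] at h0
    have h1 : x i / y i ≤ upperRatio x y :=
      le_csInf ⟨C, hC, h⟩ fun D hD => by
        rw [div_le_iff₀ h0]
        exact hD.2 i
    rwa [div_le_iff₀ h0] at h1

theorem one_le_mul_of_le_smul {n : ℕ} {x y : Fin n → ℝ} (hx : 0 ≤ x) (hx0 : x ≠ 0) {C D : ℝ}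
    (hC : 0 ≤ C) (h1 : x ≤ C • y) (h2 : y ≤ D • x) : 1 ≤ C * D := by
  obtain ⟨i, hi⟩ := Function.ne_iff.1 hx0
  have hpos : 0 < x i := lt_of_le_of_ne (hx i) (Ne.symm hi)
  have h3 := h1 i
  have h4 := h2 i
  simp only [Pi.smul_apply, smul_eq_mul] at h3 h4
  have h5 : 1 * x i ≤ C * D * x i := by nlinarith [mul_le_mul_of_nonneg_left h4 hC]
  exact le_of_mul_le_mul_right h5 hpos

theorem hilbertDist_le {n : ℕ} {x y : Fin n → ℝ} (hx : 0 ≤ x) (hy : 0 ≤ y) {C D : ℝ}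
    (hC : 0 < C) (hD : 0 < D) (h1 : x ≤ C • y) (h2 : y ≤ D • x) :
    hilbertDist x y ≤ ENNReal.ofReal (Real.log (C * D)) := by
  unfold hilbertDist
  split_ifs with h h'
  · exact zero_le
  · have hx0 : x ≠ 0 := by
      rintro rfl
      exact h ⟨rfl, le_antisymm (by simpa using h2) hy⟩
    have h3 : 1 ≤ upperRatio x y * upperRatio y x :=
      one_le_mul_of_le_smul hx hx0 (upperRatio_nonneg x y) (le_upperRatio_smul hy hC h1)
        (le_upperRatio_smul hx hD h2)
    refine ENNReal.ofReal_le_ofReal (Real.log_le_log (by linarith) ?_)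
    exact mul_le_mul (upperRatio_le hC h1) (upperRatio_le hD h2) (upperRatio_nonneg _ _) hC.le
  · exact absurd (comparable_of_le hC hD h1 h2) h'

/-- For comparable vectors the Hilbert distance is `ln (C D)` for optimal scalars `C`, `D`. -/
theorem exists_hilbertDist_eq {n : ℕ} {x y : Fin n → ℝ} (hx : 0 ≤ x) (hy : 0 ≤ y)
    (h : Comparable x y) : ∃ C D : ℝ, 0 < C ∧ 0 < D ∧ 1 ≤ C * D ∧ x ≤ C • y ∧ y ≤ D • x ∧
      hilbertDist x y = ENNReal.ofReal (Real.log (C * D)) := by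
  by_cases h0 : x = 0 ∧ y = 0
  · refine ⟨1, 1, one_pos, one_pos, by simp, by simp [h0], by simp [h0], ?_⟩
    simp [hilbertDist, h0]
  · obtain ⟨C, D, hC, hD, h1, h2⟩ := h.exists_le
    have hx0 : x ≠ 0 := by
      rintro rfl
      exact h0 ⟨rfl, le_antisymm (by simpa using h2) hy⟩
    have h1' := le_upperRatio_smul hy hC h1
    have h2' := le_upperRatio_smul hx hD h2
    have h3 := one_le_mul_of_le_smul hx hx0 (upperRatio_nonneg x y) h1' h2'
    have hC' : 0 < upperRatio x y := by
      refine (upperRatio_nonneg x y).lt_of_ne fun h => ?_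
      rw [← h] at h3
      linarith
    have hD' : 0 < upperRatio y x := by
      refine (upperRatio_nonneg y x).lt_of_ne fun h => ?_
      rw [← h] at h3
      linarith
    exact ⟨_, _, hC', hD', h3, h1', h2', by simp [hilbertDist, h0, h]⟩

theorem hilbertDist_ne_top {n : ℕ} {x y : Fin n → ℝ} (h : Comparable x y) :
    hilbertDist x y ≠ ⊤ := by
  unfold hilbertDist
  split_ifs
  · exact ENNReal.zero_ne_top
  · exact ENNReal.ofReal_ne_top

/-! ### Birkhoff contraction ratios of nonnegative matrices -/

theorem mulVec_nonneg {m n : ℕ} {A : Matrix (Fin m) (Fin n) ℝ} (hA : ∀ i j, 0 ≤ A i j)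
    {x : Fin n → ℝ} (hx : 0 ≤ x) : 0 ≤ A.mulVec x := by
  intro i
  simp only [Matrix.mulVec, dotProduct]
  exact Finset.sum_nonneg fun j _ => mul_nonneg (hA i j) (hx j)

theorem mulVec_le_smul {m n : ℕ} {A : Matrix (Fin m) (Fin n) ℝ} (hA : ∀ i j, 0 ≤ A i j)
    {x y : Fin n → ℝ} {C : ℝ} (h : x ≤ C • y) : A.mulVec x ≤ C • A.mulVec y := by
  rw [← Matrix.mulVec_smul]
  intro i
  simp only [Matrix.mulVec, dotProduct]
  exact Finset.sum_le_sum fun j _ => mul_le_mul_of_nonneg_left (h j) (hA i j)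

theorem Comparable.mulVec {m n : ℕ} {A : Matrix (Fin m) (Fin n) ℝ} (hA : ∀ i j, 0 ≤ A i j)
    {x y : Fin n → ℝ} (h : Comparable x y) : Comparable (A.mulVec x) (A.mulVec y) := by
  obtain ⟨C, D, hC, hD, h1, h2⟩ := h.exists_le
  exact comparable_of_le hC hD (mulVec_le_smul hA h1) (mulVec_le_smul hA h2)

/-- Nonnegative matrices do not increase the Hilbert metric. -/
theorem birkhoffRatio_mulVec_le_one {m n : ℕ} {A : Matrix (Fin m) (Fin n) ℝ}
    (hA : ∀ i j, 0 ≤ A i j) : birkhoffRatio (fun x => A.mulVec x) ≤ 1 := by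
  refine sInf_le ⟨one_pos, ENNReal.one_ne_top, fun x y hx hy h => ?_⟩
  obtain ⟨C, D, hC, hD, -, h1, h2, h3⟩ := exists_hilbertDist_eq hx hy h
  rw [one_mul, h3]
  exact hilbertDist_le (mulVec_nonneg hA hx) (mulVec_nonneg hA hy) hC hD (mulVec_le_smul hA h1)
    (mulVec_le_smul hA h2)

/-- A finite Birkhoff ratio is attained as a Lipschitz constant. -/
theorem hilbertDist_le_birkhoffRatio_mul {m n : ℕ} {F : (Fin n → ℝ) → (Fin m → ℝ)}
    (hF : birkhoffRatio F ≠ ⊤) {x y : Fin n → ℝ} (hx : 0 ≤ x) (hy : 0 ≤ y)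
    (h : Comparable x y) :
    hilbertDist (F x) (F y) ≤ birkhoffRatio F * hilbertDist x y := by
  have hd := hilbertDist_ne_top h
  rcases eq_or_ne (hilbertDist x y) 0 with h0 | h0
  · obtain ⟨C, hC, -⟩ := sInf_lt_iff.1 (lt_top_iff_ne_top.2 hF)
    have := hC.2.2 x y hx hy h
    rw [h0, mul_zero] at this ⊢
    exact this
  · rw [← ENNReal.div_le_iff h0 hd]
    refine le_sInf fun C hC => ?_
    rw [ENNReal.div_le_iff h0 hd]
    exact hC.2.2 x y hx hy h

/-! ### The `ℓ^p` norms and their duality maps -/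

section Norm

variable {n : ℕ} {p : ℝ}

theorem fact_one_le_ofReal (hp : 1 < p) : Fact (1 ≤ ENNReal.ofReal p) :=
  ⟨by simpa using hp.le⟩

theorem vecNorm_nonneg (hp : 1 < p) (x : Fin n → ℝ) : 0 ≤ vecNorm p x :=
  have := fact_one_le_ofReal hp
  norm_nonneg _

theorem vecNorm_smul (hp : 1 < p) (c : ℝ) (x : Fin n → ℝ) :
    vecNorm p (c • x) = |c| * vecNorm p x := by
  have := fact_one_le_ofReal hp
  simp only [vecNorm, WithLp.toLp_smul, norm_smul, Real.norm_eq_abs]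

theorem vecNorm_eq_zero (hp : 1 < p) {x : Fin n → ℝ} : vecNorm p x = 0 ↔ x = 0 := by
  have := fact_one_le_ofReal hp
  simp [vecNorm]

theorem vecNorm_pos (hp : 1 < p) {x : Fin n → ℝ} (hx : x ≠ 0) : 0 < vecNorm p x :=
  (vecNorm_nonneg hp x).lt_of_ne fun h => hx ((vecNorm_eq_zero hp).1 h.symm)

theorem ne_zero_of_vecNorm_eq_one (hp : 1 < p) {x : Fin n → ℝ} (hx : vecNorm p x = 1) :
    x ≠ 0 := by
  rintro rfl
  rw [(vecNorm_eq_zero hp).2 rfl] at hx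
  exact zero_ne_one hx

theorem vecNorm_inv_smul_self (hp : 1 < p) {x : Fin n → ℝ} (hx : x ≠ 0) :
    vecNorm p ((vecNorm p x)⁻¹ • x) = 1 := by
  have := vecNorm_pos hp hx
  rw [vecNorm_smul hp, abs_of_pos (inv_pos.2 this), inv_mul_cancel₀ this.ne']

theorem vecNorm_abs (hp : 1 < p) (x : Fin n → ℝ) : vecNorm p |x| = vecNorm p x := by
  simp [vecNorm_eq hp]

theorem vecNorm_le_vecNorm (hp : 1 < p) {x y : Fin n → ℝ} (h : ∀ i, |x i| ≤ y i) :
    vecNorm p x ≤ vecNorm p y := by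
  rw [vecNorm_eq hp, vecNorm_eq hp]
  have hp0 : 0 ≤ p := by linarith
  refine Real.rpow_le_rpow (by positivity) (Finset.sum_le_sum fun i _ => ?_) (by positivity)
  exact Real.rpow_le_rpow (abs_nonneg _) ((h i).trans (le_abs_self _)) hp0

theorem continuous_vecNorm (hp : 1 < p) : Continuous (vecNorm p : (Fin n → ℝ) → ℝ) := by
  have := fact_one_le_ofReal hp
  exact continuous_norm.comp (PiLp.continuous_toLp _ _)

theorem vecNorm_rpow (hp : 1 < p) (x : Fin n → ℝ) : vecNorm p x ^ p = ∑ i, |x i| ^ p := by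
  rw [vecNorm_eq hp, ← Real.rpow_mul (Finset.sum_nonneg fun i _ => by positivity),
    one_div_mul_cancel (by linarith), Real.rpow_one]

theorem isCompact_vecNorm_eq_one (hp : 1 < p) : IsCompact {x : Fin n → ℝ | vecNorm p x = 1} := by
  have := fact_one_le_ofReal hp
  have h := (isCompact_sphere (0 : PiLp (ENNReal.ofReal p) fun _ : Fin n => ℝ) 1).image
    (PiLp.continuous_ofLp _ _)
  convert h using 1
  ext x
  constructor
  · intro hx
    exact ⟨WithLp.toLp _ x, by simpa [vecNorm] using hx, rfl⟩
  · rintro ⟨y, hy, rfl⟩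
    simpa [vecNorm] using hy

theorem sum_mul_le_vecNorm_mul {p' : ℝ} (h : p.HolderConjugate p') (x y : Fin n → ℝ) :
    ∑ i, x i * y i ≤ vecNorm p x * vecNorm p' y := by
  rw [vecNorm_eq h.lt, vecNorm_eq h.symm.lt]
  exact Real.inner_le_Lp_mul_Lq _ _ _ h

theorem dualityMap_of_nonneg (hp : 1 < p) {x : Fin n → ℝ} (hx : 0 ≤ x) (i : Fin n) :
    dualityMap p x i = vecNorm p x ^ (1 - p) * x i ^ (p - 1) := by
  have hxi : 0 ≤ x i := hx i
  unfold dualityMap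
  congr 1
  rw [abs_of_nonneg hxi]
  rcases hxi.eq_or_lt with h | h
  · rw [← h, mul_zero, Real.zero_rpow (by linarith)]
  · rw [← Real.rpow_add_one h.ne']
    ring_nf

theorem dualityMap_nonneg (hp : 1 < p) {x : Fin n → ℝ} (hx : 0 ≤ x) : 0 ≤ dualityMap p x := by
  intro i
  rw [dualityMap_of_nonneg hp hx]
  exact mul_nonneg (Real.rpow_nonneg (vecNorm_nonneg hp x) _) (Real.rpow_nonneg (hx i) _)

theorem dualityMap_pos_iff (hp : 1 < p) {x : Fin n → ℝ} (hx : 0 ≤ x) (i : Fin n) :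
    0 < dualityMap p x i ↔ 0 < x i := by
  rw [dualityMap_of_nonneg hp hx]
  have hxi : 0 ≤ x i := hx i
  constructor
  · intro h
    refine hxi.lt_of_ne fun h0 => ?_
    rw [← h0, Real.zero_rpow (by linarith), mul_zero] at h
    exact lt_irrefl _ h
  · intro h
    have : x ≠ 0 := fun h0 => by simp [h0] at h
    exact mul_pos (Real.rpow_pos_of_pos (vecNorm_pos hp this) _) (Real.rpow_pos_of_pos h _)

theorem sum_dualityMap_mul (hp : 1 < p) {x : Fin n → ℝ} (hx : 0 ≤ x) :
    ∑ i, dualityMap p x i * x i = vecNorm p x := by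
  rcases eq_or_ne x 0 with rfl | h0
  · simp [(vecNorm_eq_zero hp).2]
  have h1 : ∀ i, dualityMap p x i * x i = vecNorm p x ^ (1 - p) * |x i| ^ p := by
    intro i
    have hxi : 0 ≤ x i := hx i
    rw [dualityMap_of_nonneg hp hx, abs_of_nonneg hxi, mul_assoc]
    congr 1
    rcases hxi.eq_or_lt with h | h
    · rw [← h, mul_zero, Real.zero_rpow (by linarith)]
    · rw [← Real.rpow_add_one h.ne']
      ring_nf
  simp_rw [h1]
  rw [← Finset.mul_sum, ← vecNorm_rpow hp, ← Real.rpow_add (vecNorm_pos hp h0)]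
  simp

theorem vecNorm_dualityMap {p' : ℝ} (h : p.HolderConjugate p') {x : Fin n → ℝ} (hx : 0 ≤ x)
    (h0 : x ≠ 0) : vecNorm p' (dualityMap p x) = 1 := by
  have hN := vecNorm_pos h.lt h0
  have hpp : (p - 1) * p' = p := h.sub_one_mul_conj
  have h1 : ∀ i, |dualityMap p x i| ^ p' = vecNorm p x ^ (-p) * |x i| ^ p := by
    intro i
    have hxi : 0 ≤ x i := hx i
    rw [abs_of_nonneg (dualityMap_nonneg h.lt hx i), dualityMap_of_nonneg h.lt hx,
      Real.mul_rpow (by positivity) (by positivity), ← Real.rpow_mul hN.le,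
      ← Real.rpow_mul hxi, hpp, abs_of_nonneg hxi]
    congr 2
    linarith
  rw [vecNorm_eq h.symm.lt]
  simp_rw [h1]
  rw [← Finset.mul_sum, ← vecNorm_rpow h.lt, ← Real.rpow_add hN]
  simp

/-- The equality case of Hölder's inequality: `J_{q*}(u)` is the only unit vector at which the
functional `u` attains its norm. -/
theorem eq_dualityMap_of_vecNorm_le {q q' : ℝ} (h : q.HolderConjugate q') {u x : Fin n → ℝ}
    (hu : 0 ≤ u) (hx : 0 ≤ x) (hu0 : u ≠ 0) (hx1 : vecNorm q x = 1)
    (hle : vecNorm q' u ≤ ∑ i, u i * x i) : x = dualityMap q' u := by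
  set N := vecNorm q' u with hNdef
  have hN : 0 < N := vecNorm_pos h.symm.lt hu0
  have hb : ∀ i, 0 ≤ u i / N := fun i => div_nonneg (hu i) hN.le
  have young : ∀ i ∈ Finset.univ,
      u i / N * x i ≤ (u i / N) ^ q' / q' + x i ^ q / q := fun i _ =>
    Real.young_inequality_of_nonneg (hb i) (hx i) h.symm
  have hs1 : ∑ i, (u i / N) ^ q' = 1 := by
    have h1 : ∀ i, (u i / N) ^ q' = |u i| ^ q' / N ^ q' := fun i => by
      rw [Real.div_rpow (hu i) hN.le, abs_of_nonneg (hu i)]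
    simp_rw [h1]
    rw [← Finset.sum_div, ← vecNorm_rpow h.symm.lt, div_self (Real.rpow_pos_of_pos hN _).ne']
  have hs2 : ∑ i, x i ^ q = 1 := by
    have h1 := vecNorm_rpow h.lt x
    rw [hx1, Real.one_rpow] at h1
    rw [h1]
    exact Finset.sum_congr rfl fun i _ => by rw [abs_of_nonneg (hx i)]
  have hs3 : 1 ≤ ∑ i, u i / N * x i := by
    have h1 : ∀ i, u i / N * x i = u i * x i / N := fun i => by ring
    simp_rw [h1]
    rw [← Finset.sum_div, le_div_iff₀ hN]
    linarith
  have hs4 : ∑ i, ((u i / N) ^ q' / q' + x i ^ q / q) = 1 := by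
    rw [Finset.sum_add_distrib, ← Finset.sum_div, ← Finset.sum_div, hs1, hs2]
    have := h.inv_add_inv_eq_one
    rw [one_div, one_div]
    linarith
  -- Young's inequality holds with equality in every coordinate.
  have heq : ∑ i, u i / N * x i = ∑ i, ((u i / N) ^ q' / q' + x i ^ q / q) :=
    le_antisymm (Finset.sum_le_sum young) (by linarith)
  have hcoord := (Finset.sum_eq_sum_iff_of_le young).1 heq
  ext i
  have h1 : (u i / N) ^ q' = x i ^ q :=
    (Real.young_inequality_eq_iff_of_nonneg (hb i) (hx i) h.symm).1 (hcoord i (Finset.mem_univ i))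
  have hq0 : q ≠ 0 := h.ne_zero
  have h2 : q' - 1 = q' * q⁻¹ := by
    have := h.symm.sub_one_mul_conj
    field_simp
    linarith
  rw [dualityMap_of_nonneg h.symm.lt hu, ← hNdef]
  have h3 : N ^ (1 - q') * u i ^ (q' - 1) = (u i / N) ^ (q' - 1) := by
    rw [Real.div_rpow (hu i) hN.le, show 1 - q' = -(q' - 1) by ring, Real.rpow_neg hN.le]
    ring
  rw [h3, h2, Real.rpow_mul (hb i), h1, ← Real.rpow_mul (hx i), mul_inv_cancel₀ hq0,
    Real.rpow_one]

theorem dualityMap_le_smul (hp : 1 < p) {x y : Fin n → ℝ} (hx : 0 ≤ x) (hy : 0 ≤ y)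
    (hy0 : y ≠ 0) {C : ℝ} (hC : 0 ≤ C) (h : x ≤ C • y) :
    dualityMap p x ≤
      (C ^ (p - 1) * (vecNorm p x ^ (1 - p) / vecNorm p y ^ (1 - p))) • dualityMap p y := by
  intro i
  have hN := Real.rpow_pos_of_pos (vecNorm_pos hp hy0) (1 - p)
  rw [Pi.smul_apply, smul_eq_mul, dualityMap_of_nonneg hp hx, dualityMap_of_nonneg hp hy]
  have h1 : x i ^ (p - 1) ≤ C ^ (p - 1) * y i ^ (p - 1) := by
    rw [← Real.mul_rpow hC (hy i)]
    exact Real.rpow_le_rpow (hx i) (h i) (by linarith)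
  calc vecNorm p x ^ (1 - p) * x i ^ (p - 1)
      ≤ vecNorm p x ^ (1 - p) * (C ^ (p - 1) * y i ^ (p - 1)) :=
        mul_le_mul_of_nonneg_left h1 (Real.rpow_nonneg (vecNorm_nonneg hp x) _)
    _ = _ := by field_simp

/-- Powers scale the Hilbert metric by the exponent, and normalization does not affect it. -/
theorem comparable_and_hilbertDist_dualityMap_le (hp : 1 < p) {x y : Fin n → ℝ} (hx : 0 ≤ x)
    (hy : 0 ≤ y) (hx0 : x ≠ 0) (hy0 : y ≠ 0) (h : Comparable x y) :
    Comparable (dualityMap p x) (dualityMap p y) ∧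
      hilbertDist (dualityMap p x) (dualityMap p y) ≤
        ENNReal.ofReal (p - 1) * hilbertDist x y := by
  obtain ⟨C, D, hC, hD, -, h1, h2, h3⟩ := exists_hilbertDist_eq hx hy h
  have hNx := Real.rpow_pos_of_pos (vecNorm_pos hp hx0) (1 - p)
  have hNy := Real.rpow_pos_of_pos (vecNorm_pos hp hy0) (1 - p)
  have h1' := dualityMap_le_smul hp hx hy hy0 hC.le h1
  have h2' := dualityMap_le_smul hp hy hx hx0 hD.le h2
  have hC' : 0 < C ^ (p - 1) * (vecNorm p x ^ (1 - p) / vecNorm p y ^ (1 - p)) := by positivity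
  have hD' : 0 < D ^ (p - 1) * (vecNorm p y ^ (1 - p) / vecNorm p x ^ (1 - p)) := by positivity
  refine ⟨comparable_of_le hC' hD' h1' h2', ?_⟩
  refine (hilbertDist_le (dualityMap_nonneg hp hx) (dualityMap_nonneg hp hy) hC' hD' h1' h2').trans
    (le_of_eq ?_)
  rw [h3, ← ENNReal.ofReal_mul (by linarith), ← Real.log_rpow (mul_pos hC hD),
    Real.mul_rpow hC.le hD.le]
  congr 2
  field_simp

/-- On the unit sphere the Hilbert metric controls the entrywise ratios. -/
theorem le_exp_hilbertDist_smul (hp : 1 < p) {x y : Fin n → ℝ} (hx : 0 ≤ x) (hy : 0 ≤ y)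
    (hx1 : vecNorm p x = 1) (hy1 : vecNorm p y = 1) (h : Comparable x y) :
    x ≤ Real.exp (hilbertDist x y).toReal • y ∧ y ≤ Real.exp (hilbertDist x y).toReal • x := by
  obtain ⟨C, D, hC, hD, hCD, h1, h2, h3⟩ := exists_hilbertDist_eq hx hy h
  have key : ∀ {u v : Fin n → ℝ} {c : ℝ}, 0 ≤ u → vecNorm p u = 1 → vecNorm p v = 1 → 0 < c →
      u ≤ c • v → 1 ≤ c := by
    intro u v c hu hu1 hv1 hc hle
    have h4 := vecNorm_le_vecNorm hp (x := u) (y := c • v) fun i => by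
      rw [abs_of_nonneg (hu i)]
      exact hle i
    rwa [vecNorm_smul hp, hu1, hv1, abs_of_pos hc, mul_one] at h4
  have hC1 := key hx hx1 hy1 hC h1
  have hD1 := key hy hy1 hx1 hD h2
  rw [h3, ENNReal.toReal_ofReal (Real.log_nonneg hCD), Real.exp_log (mul_pos hC hD)]
  refine ⟨fun i => (h1 i).trans ?_, fun i => (h2 i).trans ?_⟩
  · exact mul_le_mul_of_nonneg_right (le_mul_of_one_le_right hC.le hD1) (hy i)
  · exact mul_le_mul_of_nonneg_right (le_mul_of_one_le_left hD.le hC1) (hx i)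

end Norm

/-! ### Positivity along one step of the power method -/

/-- The functional `Aᵀ J_p(Ax)`, the gradient of `x ↦ ‖Ax‖_p` where `Ax ≠ 0`. -/
noncomputable def normGradient {m n : ℕ} (A : Matrix (Fin m) (Fin n) ℝ) (p : ℝ)
    (x : Fin n → ℝ) : Fin n → ℝ :=
  A.transpose.mulVec (dualityMap p (A.mulVec x))

theorem powerStep_eq {m n : ℕ} (A : Matrix (Fin m) (Fin n) ℝ) (p q : ℝ) (x : Fin n → ℝ) :
    powerStep A p q x = dualityMap (Real.conjExponent q) (normGradient A p x) := rfl

section Step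

variable {m n : ℕ} {A : Matrix (Fin m) (Fin n) ℝ} {p q : ℝ}

theorem exists_pos_of_ne_zero {x : Fin n → ℝ} (hx : 0 ≤ x) (hx0 : x ≠ 0) : ∃ j, 0 < x j := by
  obtain ⟨j, hj⟩ := Function.ne_iff.1 hx0
  exact ⟨j, lt_of_le_of_ne (hx j) (Ne.symm hj)⟩

theorem mulVec_pos_of_pos (hA : ∀ i j, 0 ≤ A i j) {x : Fin n → ℝ} (hx : 0 ≤ x) {k : Fin m}
    {j : Fin n} (hk : 0 < A k j) (hj : 0 < x j) : 0 < A.mulVec x k := by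
  simp only [Matrix.mulVec, dotProduct]
  exact Finset.sum_pos' (fun i _ => mul_nonneg (hA k i) (hx i))
    ⟨j, Finset.mem_univ j, mul_pos hk hj⟩

theorem normGradient_nonneg (hA : ∀ i j, 0 ≤ A i j) (hp : 1 < p) {x : Fin n → ℝ} (hx : 0 ≤ x) :
    0 ≤ normGradient A p x :=
  mulVec_nonneg (fun i j => hA j i) (dualityMap_nonneg hp (mulVec_nonneg hA hx))

theorem normGradient_pos (hA : ∀ i j, 0 ≤ A i j) (hp : 1 < p) {x : Fin n → ℝ} (hx : 0 ≤ x)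
    {k : Fin m} {i j : Fin n} (hi : 0 < A k i) (hj : 0 < A k j) (hxj : 0 < x j) :
    0 < normGradient A p x i :=
  mulVec_pos_of_pos (A := A.transpose) (fun i j => hA j i)
    (dualityMap_nonneg hp (mulVec_nonneg hA hx)) hi
    ((dualityMap_pos_iff hp (mulVec_nonneg hA hx) k).2 (mulVec_pos_of_pos hA hx hj hxj))

theorem mulVec_ne_zero (hA : ∀ i j, 0 ≤ A i j) (hcol : ∀ j, ∃ k, 0 < A k j) {x : Fin n → ℝ}
    (hx : 0 ≤ x) (hx0 : x ≠ 0) : A.mulVec x ≠ 0 := by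
  obtain ⟨j, hj⟩ := exists_pos_of_ne_zero hx hx0
  obtain ⟨k, hk⟩ := hcol j
  exact fun h => (mulVec_pos_of_pos hA hx hk hj).ne' (congrFun h k)

theorem normGradient_ne_zero (hA : ∀ i j, 0 ≤ A i j) (hcol : ∀ j, ∃ k, 0 < A k j) (hp : 1 < p)
    {x : Fin n → ℝ} (hx : 0 ≤ x) (hx0 : x ≠ 0) : normGradient A p x ≠ 0 := by
  obtain ⟨j, hj⟩ := exists_pos_of_ne_zero hx hx0
  obtain ⟨k, hk⟩ := hcol j
  exact fun h => (normGradient_pos hA hp hx hk hk hj).ne' (congrFun h j)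

theorem powerStep_pos (hA : ∀ i j, 0 ≤ A i j) (hcol : ∀ j, ∃ k, 0 < A k j) (hp : 1 < p)
    (hq : 1 < q) {x : Fin n → ℝ} (hx : ∀ i, 0 < x i) (i : Fin n) : 0 < powerStep A p q x i := by
  have hx' : 0 ≤ x := fun i => (hx i).le
  obtain ⟨k, hk⟩ := hcol i
  exact (dualityMap_pos_iff (Real.HolderConjugate.conjExponent hq).symm.lt
    (normGradient_nonneg hA hp hx') i).2 (normGradient_pos hA hp hx' hk hk (hx i))

theorem vecNorm_powerStep (hA : ∀ i j, 0 ≤ A i j) (hcol : ∀ j, ∃ k, 0 < A k j) (hp : 1 < p)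
    (hq : 1 < q) {x : Fin n → ℝ} (hx : 0 ≤ x) (hx0 : x ≠ 0) :
    vecNorm q (powerStep A p q x) = 1 :=
  vecNorm_dualityMap (Real.HolderConjugate.conjExponent hq).symm (normGradient_nonneg hA hp hx)
    (normGradient_ne_zero hA hcol hp hx hx0)

/-- One step of the power method contracts the Hilbert metric by the factor `τ`. -/
theorem hilbertDist_powerStep_le (hA : ∀ i j, 0 ≤ A i j) (hcol : ∀ j, ∃ k, 0 < A k j)
    (hp : 1 < p) (hq : 1 < q) {x y : Fin n → ℝ} (hx : 0 ≤ x) (hy : 0 ≤ y) (hx0 : x ≠ 0)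
    (hy0 : y ≠ 0) (h : Comparable x y) :
    hilbertDist (powerStep A p q x) (powerStep A p q y) ≤ tau A p q * hilbertDist x y := by
  have hA' : ∀ i j, 0 ≤ A.transpose i j := fun i j => hA j i
  have hr := Real.HolderConjugate.conjExponent hq
  have hfin : birkhoffRatio (fun x => A.mulVec x) ≠ ⊤ :=
    ne_top_of_le_ne_top ENNReal.one_ne_top (birkhoffRatio_mulVec_le_one hA)
  have hfin' : birkhoffRatio (fun x => A.transpose.mulVec x) ≠ ⊤ :=
    ne_top_of_le_ne_top ENNReal.one_ne_top (birkhoffRatio_mulVec_le_one hA')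
  have hAx := mulVec_nonneg hA hx
  have hAy := mulVec_nonneg hA hy
  have h1 := hilbertDist_le_birkhoffRatio_mul hfin hx hy h
  obtain ⟨h2c, h2⟩ := comparable_and_hilbertDist_dualityMap_le hp hAx hAy
    (mulVec_ne_zero hA hcol hx hx0) (mulVec_ne_zero hA hcol hy hy0) (h.mulVec hA)
  have h3 := hilbertDist_le_birkhoffRatio_mul hfin' (dualityMap_nonneg hp hAx)
    (dualityMap_nonneg hp hAy) h2c
  obtain ⟨-, h4⟩ := comparable_and_hilbertDist_dualityMap_le hr.symm.lt
    (normGradient_nonneg hA hp hx) (normGradient_nonneg hA hp hy)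
    (normGradient_ne_zero hA hcol hp hx hx0) (normGradient_ne_zero hA hcol hp hy hy0)
    (h2c.mulVec hA')
  have hexp : (p - 1) / (q - 1) = (Real.conjExponent q - 1) * (p - 1) := by
    have : q - 1 ≠ 0 := by linarith
    rw [Real.conjExponent]
    field_simp
    ring
  have hexp' : ENNReal.ofReal ((p - 1) / (q - 1)) =
      ENNReal.ofReal (Real.conjExponent q - 1) * ENNReal.ofReal (p - 1) := by
    rw [hexp, ENNReal.ofReal_mul (by linarith [hr.symm.lt])]
  rw [powerStep_eq, powerStep_eq, tau, hexp']
  refine h4.trans ?_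
  calc _ ≤ ENNReal.ofReal (Real.conjExponent q - 1) *
        (birkhoffRatio (fun x => A.transpose.mulVec x) *
          (ENNReal.ofReal (p - 1) *
            (birkhoffRatio (fun x => A.mulVec x) * hilbertDist x y))) := by
        gcongr
        refine h3.trans ?_
        gcongr
        refine h2.trans ?_
        gcongr
    _ = _ := by ring

end Step

/-! ### The norm-attaining vector -/

section Maximizer

variable {m n : ℕ} {A : Matrix (Fin m) (Fin n) ℝ} {p q : ℝ}

theorem vecNorm_mulVec_le_abs (hA : ∀ i j, 0 ≤ A i j) (hp : 1 < p) (x : Fin n → ℝ) :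
    vecNorm p (A.mulVec x) ≤ vecNorm p (A.mulVec |x|) := by
  refine vecNorm_le_vecNorm hp fun i => ?_
  simp only [Matrix.mulVec, dotProduct]
  refine (Finset.abs_sum_le_sum_abs _ _).trans (Finset.sum_le_sum fun j _ => ?_)
  rw [abs_mul, abs_of_nonneg (hA i j), Pi.abs_apply]

theorem continuous_vecNorm_mulVec (hp : 1 < p) :
    Continuous fun x : Fin n → ℝ => vecNorm p (A.mulVec x) :=
  (continuous_vecNorm hp).comp (Continuous.matrix_mulVec continuous_const continuous_id)

theorem exists_nonneg_maximizer (hn : 0 < n) (hA : ∀ i j, 0 ≤ A i j) (hp : 1 < p) (hq : 1 < q) :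
    ∃ x : Fin n → ℝ, 0 ≤ x ∧ vecNorm q x = 1 ∧
      ∀ z, vecNorm p (A.mulVec z) ≤ vecNorm p (A.mulVec x) * vecNorm q z := by
  have hne : (fun _ => 1 : Fin n → ℝ) ≠ 0 := fun h => one_ne_zero (congrFun h ⟨0, hn⟩)
  obtain ⟨x, hx, hmax⟩ := (isCompact_vecNorm_eq_one (n := n) hq).exists_isMaxOn
    ⟨_, vecNorm_inv_smul_self hq hne⟩ (continuous_vecNorm_mulVec (A := A) hp).continuousOn
  refine ⟨|x|, abs_nonneg x, (vecNorm_abs hq x).trans hx, fun z => ?_⟩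
  rcases eq_or_ne z 0 with rfl | hz
  · simp [(vecNorm_eq_zero hp).2, (vecNorm_eq_zero hq).2]
  · have hN := vecNorm_pos hq hz
    have h1 : vecNorm p (A.mulVec ((vecNorm q z)⁻¹ • z)) ≤ vecNorm p (A.mulVec x) :=
      hmax (vecNorm_inv_smul_self hq hz)
    rw [Matrix.mulVec_smul, vecNorm_smul hp, abs_of_pos (inv_pos.2 hN), inv_mul_le_iff₀ hN] at h1
    have h2 := mul_le_mul_of_nonneg_left (vecNorm_mulVec_le_abs hA hp x) hN.le
    linarith

theorem isGreatest_normQuotients {x : Fin n → ℝ} (hq : 1 < q)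
    (hx1 : vecNorm q x = 1)
    (hmax : ∀ z, vecNorm p (A.mulVec z) ≤ vecNorm p (A.mulVec x) * vecNorm q z) :
    IsGreatest (normQuotients A q p) (vecNorm p (A.mulVec x)) := by
  refine ⟨⟨x, ne_zero_of_vecNorm_eq_one hq hx1, by rw [hx1, div_one]⟩, ?_⟩
  rintro r ⟨z, hz, rfl⟩
  rw [div_le_iff₀ (vecNorm_pos hq hz)]
  exact hmax z

theorem sum_transpose_mulVec_mul (A : Matrix (Fin m) (Fin n) ℝ) (v : Fin m → ℝ)
    (z : Fin n → ℝ) :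
    ∑ i, A.transpose.mulVec v i * z i = ∑ k, v k * A.mulVec z k := by
  have := Matrix.dotProduct_mulVec v A z
  rw [← Matrix.mulVec_transpose] at this
  exact this.symm

/-- A nonnegative unit maximizer `x` is a fixed point of the power method. The dual unit vector
`J_p(Ax)` shows that `Aᵀ J_p(Ax)` has dual norm at most `‖Ax‖_p`, and `x` attains this norm. -/
theorem powerStep_eq_self_of_maximizer (hA : ∀ i j, 0 ≤ A i j) (hcol : ∀ j, ∃ k, 0 < A k j)
    (hp : 1 < p) (hq : 1 < q) {x : Fin n → ℝ} (hx : 0 ≤ x) (hx1 : vecNorm q x = 1)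
    (hmax : ∀ z, vecNorm p (A.mulVec z) ≤ vecNorm p (A.mulVec x) * vecNorm q z) :
    powerStep A p q x = x := by
  have hr := Real.HolderConjugate.conjExponent hq
  have hs := Real.HolderConjugate.conjExponent hp
  have hx0 : x ≠ 0 := ne_zero_of_vecNorm_eq_one hq hx1
  have hAx := mulVec_nonneg hA hx
  have hg := normGradient_nonneg hA hp hx
  have hg0 := normGradient_ne_zero hA hcol hp hx hx0
  refine (eq_dualityMap_of_vecNorm_le hr hg hx hg0 hx1 ?_).symm
  have h1 : ∑ i, normGradient A p x i * x i = vecNorm p (A.mulVec x) := by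
    rw [normGradient, sum_transpose_mulVec_mul, sum_dualityMap_mul hp hAx]
  rw [h1]
  set z := powerStep A p q x with hz
  have hz1 : vecNorm q z = 1 := vecNorm_powerStep hA hcol hp hq hx hx0
  calc vecNorm (Real.conjExponent q) (normGradient A p x)
      = ∑ i, normGradient A p x i * z i := by
        rw [← sum_dualityMap_mul hr.symm.lt hg]
        exact Finset.sum_congr rfl fun i _ => mul_comm _ _
    _ = ∑ k, A.mulVec z k * dualityMap p (A.mulVec x) k := by
        rw [normGradient, sum_transpose_mulVec_mul]
        exact Finset.sum_congr rfl fun i _ => mul_comm _ _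
    _ ≤ vecNorm p (A.mulVec z) * vecNorm (Real.conjExponent p) (dualityMap p (A.mulVec x)) :=
        sum_mul_le_vecNorm_mul hs _ _
    _ = vecNorm p (A.mulVec z) := by
        rw [vecNorm_dualityMap hs hAx (mulVec_ne_zero hA hcol hx hx0), mul_one]
    _ ≤ vecNorm p (A.mulVec x) := by
        have := hmax z
        rwa [hz1, mul_one] at this

theorem exists_pos_of_transpose_mul_pos (hA : ∀ i j, 0 ≤ A i j) {i j : Fin n}
    (h : 0 < (A.transpose * A) i j) : ∃ k, 0 < A k i ∧ 0 < A k j := by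
  rw [Matrix.mul_apply] at h
  obtain ⟨k, -, hk⟩ := Finset.exists_lt_of_sum_lt (s := Finset.univ) (f := fun _ => (0 : ℝ))
    (g := fun k => A.transpose i k * A k j) (by simpa using h)
  exact ⟨k, pos_of_mul_pos_left hk (hA k j), pos_of_mul_pos_right hk (hA k i)⟩

theorem exists_pos_col_of_irreducible (hA : ∀ i j, 0 ≤ A i j)
    (hirr : (A.transpose * A).IsIrreducible) (j : Fin n) : ∃ k, 0 < A k j := by
  obtain ⟨r, hr, h⟩ := (Matrix.isIrreducible_iff_exists_pow_pos hirr.nonneg).1 hirr j j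
  obtain ⟨s, rfl⟩ := Nat.exists_eq_succ_of_ne_zero hr.ne'
  rw [pow_succ', Matrix.mul_apply] at h
  obtain ⟨l, -, hl⟩ := Finset.exists_lt_of_sum_lt (s := Finset.univ) (f := fun _ => (0 : ℝ))
    (g := fun l => (A.transpose * A) j l * ((A.transpose * A) ^ s) l j) (by simpa using h)
  obtain ⟨k, hk, -⟩ := exists_pos_of_transpose_mul_pos hA
    (pos_of_mul_pos_left hl (Matrix.pow_apply_nonneg hirr.nonneg s l j))
  exact ⟨k, hk⟩

/-- The support of a nonzero nonnegative fixed point is closed under the edges of the graph of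
`AᵀA`, so by irreducibility it is everything. -/
theorem pos_of_powerStep_eq_self (hA : ∀ i j, 0 ≤ A i j)
    (hirr : (A.transpose * A).IsIrreducible) (hp : 1 < p) (hq : 1 < q) {x : Fin n → ℝ}
    (hx : 0 ≤ x) (hx0 : x ≠ 0) (hfix : powerStep A p q x = x) (i : Fin n) : 0 < x i := by
  have hr := Real.HolderConjugate.conjExponent hq
  have step : ∀ i j, 0 < (A.transpose * A) i j → 0 < x j → 0 < x i := by
    intro i j hij hj
    obtain ⟨k, hi, hj'⟩ := exists_pos_of_transpose_mul_pos hA hij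
    rw [← hfix]
    exact (dualityMap_pos_iff hr.symm.lt (normGradient_nonneg hA hp hx) i).2
      (normGradient_pos hA hp hx hi hj' hj)
  have steps : ∀ (r : ℕ) (i j : Fin n), 0 < ((A.transpose * A) ^ r) i j → 0 < x j → 0 < x i := by
    intro r
    induction r with
    | zero =>
      intro i j hij hj
      rcases eq_or_ne i j with rfl | hne
      · exact hj
      · simp [Matrix.one_apply_ne hne] at hij
    | succ s ih =>
      intro i j hij hj
      rw [pow_succ', Matrix.mul_apply] at hij
      obtain ⟨l, -, hl⟩ := Finset.exists_lt_of_sum_lt (s := Finset.univ) (f := fun _ => (0 : ℝ))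
        (g := fun l => (A.transpose * A) i l * ((A.transpose * A) ^ s) l j) (by simpa using hij)
      exact step i l
        (pos_of_mul_pos_left hl (Matrix.pow_apply_nonneg hirr.nonneg s l j))
        (ih l j (pos_of_mul_pos_right hl (hirr.nonneg i l)) hj)
  obtain ⟨j, hj⟩ := exists_pos_of_ne_zero hx hx0
  obtain ⟨r, -, h⟩ := (Matrix.isIrreducible_iff_exists_pow_pos hirr.nonneg).1 hirr i j
  exact steps r i j h hj

end Maximizer

/-! ### Convergence of the power method -/

section Convergence

variable {m n : ℕ} {A : Matrix (Fin m) (Fin n) ℝ} {p q : ℝ}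

theorem powerSeq_pos_and_vecNorm_eq_one (hn : 0 < n) (hA : ∀ i j, 0 ≤ A i j)
    (hcol : ∀ j, ∃ k, 0 < A k j) (hp : 1 < p) (hq : 1 < q) {x₀ : Fin n → ℝ}
    (hx₀ : ∀ i, 0 < x₀ i) (k : ℕ) :
    (∀ i, 0 < powerSeq A p q x₀ k i) ∧ vecNorm q (powerSeq A p q x₀ k) = 1 := by
  have hne : x₀ ≠ 0 := fun h => (hx₀ ⟨0, hn⟩).ne' (congrFun h _)
  induction k with
  | zero =>
    exact ⟨fun i => mul_pos (inv_pos.2 (vecNorm_pos hq hne)) (hx₀ i),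
      vecNorm_inv_smul_self hq hne⟩
  | succ k ih =>
    exact ⟨powerStep_pos hA hcol hp hq ih.1,
      vecNorm_powerStep hA hcol hp hq (fun i => (ih.1 i).le)
        (ne_zero_of_vecNorm_eq_one hq ih.2)⟩

theorem hilbertDist_powerSeq_le (hn : 0 < n) (hA : ∀ i j, 0 ≤ A i j)
    (hcol : ∀ j, ∃ k, 0 < A k j) (hp : 1 < p) (hq : 1 < q) {x₀ z : Fin n → ℝ}
    (hx₀ : ∀ i, 0 < x₀ i) (hz : ∀ i, 0 < z i) (hz0 : z ≠ 0) (hfix : powerStep A p q z = z)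
    (k : ℕ) :
    hilbertDist (powerSeq A p q x₀ k) z ≤
      tau A p q ^ k * hilbertDist (powerSeq A p q x₀ 0) z := by
  induction k with
  | zero => simp
  | succ k ih =>
    obtain ⟨hpos, hnorm⟩ := powerSeq_pos_and_vecNorm_eq_one hn hA hcol hp hq hx₀ k
    have h := hilbertDist_powerStep_le hA hcol hp hq (fun i => (hpos i).le) (fun i => (hz i).le)
      (ne_zero_of_vecNorm_eq_one hq hnorm) hz0 (comparable_of_pos hpos hz)
    rw [hfix] at h
    calc _ ≤ tau A p q * hilbertDist (powerSeq A p q x₀ k) z := h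
      _ ≤ tau A p q * (tau A p q ^ k * hilbertDist (powerSeq A p q x₀ 0) z) := by gcongr
      _ = _ := by ring

/-- Convergence in the Hilbert metric implies convergence on the unit sphere. -/
theorem tendsto_of_hilbertDist_tendsto_zero (hp : 1 < p) {x : ℕ → Fin n → ℝ} {z : Fin n → ℝ}
    (hx : ∀ k i, 0 < x k i) (hx1 : ∀ k, vecNorm p (x k) = 1) (hz : ∀ i, 0 < z i)
    (hz1 : vecNorm p z = 1) (h : Tendsto (fun k => hilbertDist (x k) z) atTop (𝓝 0)) :
    Tendsto x atTop (𝓝 z) := by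
  have hd : Tendsto (fun k => (hilbertDist (x k) z).toReal) atTop (𝓝 0) := by
    simpa [Function.comp_def] using (ENNReal.tendsto_toReal ENNReal.zero_ne_top).comp h
  have hbound := fun k => le_exp_hilbertDist_smul hp (fun i => (hx k i).le) (fun i => (hz i).le)
    (hx1 k) hz1 (comparable_of_pos (hx k) hz)
  rw [tendsto_pi_nhds]
  intro i
  have hlow : Tendsto (fun k => Real.exp (-(hilbertDist (x k) z).toReal) * z i) atTop
      (𝓝 (z i)) := by
    simpa using ((Real.continuous_exp.tendsto _).comp hd.neg).mul_const (z i)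
  have hupp : Tendsto (fun k => Real.exp (hilbertDist (x k) z).toReal * z i) atTop
      (𝓝 (z i)) := by
    simpa using ((Real.continuous_exp.tendsto _).comp hd).mul_const (z i)
  refine tendsto_of_tendsto_of_tendsto_of_le_of_le hlow hupp (fun k => ?_) fun k => ?_
  · have h1 : z i ≤ Real.exp (hilbertDist (x k) z).toReal * x k i := (hbound k).2 i
    show Real.exp (-(hilbertDist (x k) z).toReal) * z i ≤ x k i
    rw [Real.exp_neg, inv_mul_le_iff₀ (Real.exp_pos _)]
    exact h1
  · exact (hbound k).1 i

theorem tendsto_powerSeq (hn : 0 < n) (hA : ∀ i j, 0 ≤ A i j)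
    (hcol : ∀ j, ∃ k, 0 < A k j) (hp : 1 < p) (hq : 1 < q) (hτ : tau A p q < 1)
    {x₀ z : Fin n → ℝ} (hx₀ : ∀ i, 0 < x₀ i) (hz : ∀ i, 0 < z i) (hz1 : vecNorm q z = 1)
    (hfix : powerStep A p q z = z) :
    Tendsto (fun k => powerSeq A p q x₀ k) atTop (𝓝 z) := by
  have hpos := fun k => (powerSeq_pos_and_vecNorm_eq_one hn hA hcol hp hq hx₀ k).1
  have hnorm := fun k => (powerSeq_pos_and_vecNorm_eq_one hn hA hcol hp hq hx₀ k).2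
  refine tendsto_of_hilbertDist_tendsto_zero hq hpos hnorm hz hz1 ?_
  have hfin := hilbertDist_ne_top (comparable_of_pos (hpos 0) hz)
  have hlim : Tendsto (fun k => tau A p q ^ k * hilbertDist (powerSeq A p q x₀ 0) z) atTop
      (𝓝 0) := by
    simpa using ENNReal.Tendsto.mul_const (ENNReal.tendsto_pow_atTop_nhds_zero_of_lt_one hτ)
      (Or.inr hfin)
  exact tendsto_of_tendsto_of_tendsto_of_le_of_le tendsto_const_nhds hlim (fun _ => zero_le)
    (hilbertDist_powerSeq_le hn hA hcol hp hq hx₀ hz (ne_zero_of_vecNorm_eq_one hq hz1) hfix)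

end Convergence

/-! ### Two-by-two matrices with small contraction ratio -/

theorem hilbertDist_fin_two_le {u v : Fin 2 → ℝ} (hu : ∀ i, 0 < u i) (hv : ∀ i, 0 < v i) {R : ℝ}
    (h1 : u 0 * v 1 ≤ R * (v 0 * u 1)) (h2 : u 1 * v 0 ≤ R * (v 1 * u 0)) :
    hilbertDist u v ≤ ENNReal.ofReal (Real.log R) := by
  -- The optimal scalars are the larger entrywise ratio and the inverse of the smaller one.
  have key : ∀ i j : Fin 2, (∀ k, k = i ∨ k = j) → u j * v i ≤ u i * v j →
      u i * v j ≤ R * (v i * u j) → hilbertDist u v ≤ ENNReal.ofReal (Real.log R) := by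
    intro i j hij hle hR
    have hui := hu i
    have huj := hu j
    have hvi := hv i
    have hvj := hv j
    refine (hilbertDist_le (C := u i / v i) (D := v j / u j) (fun k => (hu k).le)
      (fun k => (hv k).le) (by positivity) (by positivity) (fun k => ?_) fun k => ?_).trans
      (ENNReal.ofReal_le_ofReal (Real.log_le_log (by positivity) ?_))
    · rw [Pi.smul_apply, smul_eq_mul, div_mul_eq_mul_div, le_div_iff₀ hvi]
      rcases hij k with rfl | rfl
      · exact le_rfl
      · exact hle
    · rw [Pi.smul_apply, smul_eq_mul, div_mul_eq_mul_div, le_div_iff₀ huj]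
      rcases hij k with rfl | rfl
      · linarith
      · exact le_rfl
    · rw [div_mul_div_comm, div_le_iff₀ (by positivity)]
      exact hR
  rcases le_total (u 1 * v 0) (u 0 * v 1) with h | h
  · exact key 0 1 (by decide) h h1
  · exact key 1 0 (by decide) h h2

/-- With `A` this matrix, `(Ax)₀ (Ay)₁ = (Ay)₀ (Ax)₁ + det A * (x₀ y₁ - x₁ y₀)` and
`x₀ y₁ ≤ (Ay)₀ (Ax)₁`, so the distance of `Ax` and `Ay` is small when `det A = a² - 1` is. -/
theorem birkhoffRatio_fin_two_le {a : ℝ} (ha : 1 < a) :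
    birkhoffRatio (fun x => (!![a, 1; 1, a] : Matrix (Fin 2) (Fin 2) ℝ).mulVec x) ≤
      ENNReal.ofReal (a ^ 2 - 1) := by
  have hδ : 0 < a ^ 2 - 1 := by nlinarith
  refine sInf_le ⟨ENNReal.ofReal_pos.2 hδ, ENNReal.ofReal_ne_top, fun x y hx hy h => ?_⟩
  by_cases h0 : x = 0 ∧ y = 0
  · simp [hilbertDist, h0]
  obtain ⟨C, D, hC, hD, hCD, h1, h2, h3⟩ := exists_hilbertDist_eq hx hy h
  have hx0 : x ≠ 0 := by
    rintro rfl
    exact h0 ⟨rfl, le_antisymm (by simpa using h2) hy⟩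
  have hy0 : y ≠ 0 := by
    rintro rfl
    exact h0 ⟨le_antisymm (by simpa using h1) hx, rfl⟩
  have hpos : ∀ z : Fin 2 → ℝ, 0 ≤ z → z ≠ 0 →
      ∀ i, 0 < (!![a, 1; 1, a] : Matrix (Fin 2) (Fin 2) ℝ).mulVec z i := by
    intro z hz hz0 i
    obtain ⟨j, hj⟩ := exists_pos_of_ne_zero hz hz0
    have hA : ∀ i j, 0 < (!![a, 1; 1, a] : Matrix (Fin 2) (Fin 2) ℝ) i j := by
      intro i j
      fin_cases i <;> fin_cases j <;> simp <;> linarith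
    exact mulVec_pos_of_pos (fun i j => (hA i j).le) hz (hA i j) hj
  have hlog : 1 - 1 / (C * D) ≤ Real.log (C * D) := by
    rw [one_div]
    exact Real.one_sub_inv_le_log_of_pos (by positivity)
  have hR : 1 + (a ^ 2 - 1) * (1 - 1 / (C * D)) ≤
      Real.exp ((a ^ 2 - 1) * Real.log (C * D)) := by
    have := Real.add_one_le_exp ((a ^ 2 - 1) * Real.log (C * D))
    nlinarith [mul_le_mul_of_nonneg_left hlog hδ.le]
  have bound : ∀ s t s' t' : ℝ, 0 ≤ s → 0 ≤ t → 0 ≤ s' → 0 ≤ t' → s ≤ C * s' → t' ≤ D * t →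
      (a * s + t) * (s' + a * t') ≤
        Real.exp ((a ^ 2 - 1) * Real.log (C * D)) * ((a * s' + t') * (s + a * t)) := by
    intro s t s' t' hs ht hs' ht' hss htt
    have ha0 : 0 ≤ a := by linarith
    have hprod : s * t' ≤ C * D * (s' * t) := by
      have := mul_le_mul hss htt ht' (by positivity)
      linarith
    have hq : 1 / (C * D) * (s * t') ≤ s' * t := by
      rw [one_div, inv_mul_le_iff₀ (by positivity)]
      exact hprod
    have hinv : 0 ≤ 1 - 1 / (C * D) := by
      rw [sub_nonneg, div_le_one (by positivity)]
      exact hCD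
    have hden : s * t' ≤ (a * s' + t') * (s + a * t) := by
      have : 0 ≤ a * s' * s + a * s' * (a * t) + t' * (a * t) := by positivity
      linarith
    have hdiff : s * t' - s' * t ≤ (1 - 1 / (C * D)) * ((a * s' + t') * (s + a * t)) := by
      have := mul_le_mul_of_nonneg_left hden hinv
      linarith
    have hR' := mul_le_mul_of_nonneg_right hR
      (show 0 ≤ (a * s' + t') * (s + a * t) by positivity)
    have := mul_le_mul_of_nonneg_left hdiff hδ.le
    linarith
  have hx' := fun i => hx i
  have hy' := fun i => hy i
  have h1' : ∀ i, x i ≤ C * y i := h1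
  have h2' : ∀ i, y i ≤ D * x i := h2
  have b1 := bound (x 0) (x 1) (y 0) (y 1) (hx' 0) (hx' 1) (hy' 0) (hy' 1) (h1' 0) (h2' 1)
  have b2 := bound (x 1) (x 0) (y 1) (y 0) (hx' 1) (hx' 0) (hy' 1) (hy' 0) (h1' 1) (h2' 0)
  rw [h3, ← ENNReal.ofReal_mul hδ.le, ← Real.log_exp ((a ^ 2 - 1) * Real.log (C * D))]
  refine hilbertDist_fin_two_le (hpos x hx hx0) (hpos y hy hy0) ?_ ?_
  · simp only [Matrix.mulVec, dotProduct, Fin.sum_univ_two, Matrix.of_apply, Matrix.cons_val',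
      Matrix.cons_val_zero, Matrix.cons_val_one, Matrix.cons_val_fin_one]
    linarith
  · simp only [Matrix.mulVec, dotProduct, Fin.sum_univ_two, Matrix.of_apply, Matrix.cons_val',
      Matrix.cons_val_zero, Matrix.cons_val_one, Matrix.cons_val_fin_one]
    linarith

theorem exists_pos_fin_two_tau_lt_one {p q : ℝ} (hp : 1 < p) (hq : 1 < q) :
    ∃ A : Matrix (Fin 2) (Fin 2) ℝ, (∀ i j, 0 < A i j) ∧ A.det ≠ 0 ∧
      (A.transpose * A).IsIrreducible ∧ tau A p q < 1 := by
  set r := (p - 1) / (q - 1) with hr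
  have hr0 : 0 < r := div_pos (by linarith) (by linarith)
  -- With `a² = 1 + 1 / (1 + r)` both contraction ratios are at most `1 / (1 + r)`.
  set a := Real.sqrt (1 + 1 / (1 + r)) with ha_def
  have ha2 : a ^ 2 - 1 = 1 / (1 + r) := by
    rw [ha_def, Real.sq_sqrt (by positivity)]
    ring
  have hδ : 0 < 1 / (1 + r) := by positivity
  have ha : 1 < a := by
    rw [ha_def, Real.lt_sqrt (by norm_num)]
    linarith
  have hA : ∀ i j, 0 < (!![a, 1; 1, a] : Matrix (Fin 2) (Fin 2) ℝ) i j := by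
    intro i j
    fin_cases i <;> fin_cases j <;> simp <;> linarith
  have hT : (!![a, 1; 1, a] : Matrix (Fin 2) (Fin 2) ℝ).transpose = !![a, 1; 1, a] := by
    ext i j
    fin_cases i <;> fin_cases j <;> rfl
  refine ⟨!![a, 1; 1, a], hA, ?_, ?_, ?_⟩
  · rw [Matrix.det_fin_two_of]
    have : a * a - 1 * 1 = 1 / (1 + r) := by linarith
    rw [this]
    exact hδ.ne'
  · have hB : ∀ i j, 0 < ((!![a, 1; 1, a] : Matrix (Fin 2) (Fin 2) ℝ).transpose *
        !![a, 1; 1, a]) i j := by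
      intro i j
      rw [Matrix.mul_apply]
      exact Finset.sum_pos (fun k _ => mul_pos (hA k i) (hA k j)) Finset.univ_nonempty
    rw [Matrix.isIrreducible_iff_exists_pow_pos fun i j => (hB i j).le]
    exact fun i j => ⟨1, one_pos, by rw [pow_one]; exact hB i j⟩
  · have hκ := birkhoffRatio_fin_two_le ha
    rw [ha2] at hκ
    rw [tau, hT, ← hr]
    calc _ ≤ ENNReal.ofReal (1 / (1 + r)) * ENNReal.ofReal (1 / (1 + r)) * ENNReal.ofReal r := by
          gcongr
      _ = ENNReal.ofReal (1 / (1 + r) * (1 / (1 + r)) * r) := by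
          rw [← ENNReal.ofReal_mul hδ.le, ← ENNReal.ofReal_mul (by positivity)]
      _ < 1 := by
          rw [ENNReal.ofReal_lt_one, div_mul_div_comm, div_mul_eq_mul_div,
            div_lt_one (by positivity)]
          nlinarith

end PowerMethod

theorem mainTheorem2 (p q : ℝ) (hp : 1 < p) (hq : 1 < q) :
    (∀ (m n : ℕ) (A : Matrix (Fin m) (Fin n) ℝ), 0 < n → (∀ i j, 0 ≤ A i j) →
      (A.transpose * A).IsIrreducible → PowerMethod.tau A p q < 1 →
      IsGreatest (PowerMethod.normQuotients A q p) (PowerMethod.matNorm A q p) ∧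
      ∃ xp : Fin n → ℝ, (∀ i, 0 < xp i) ∧ PowerMethod.vecNorm q xp = 1 ∧
        PowerMethod.vecNorm p (A.mulVec xp) = PowerMethod.matNorm A q p ∧
        ∀ x₀ : Fin n → ℝ, (∀ i, 0 < x₀ i) →
          Filter.Tendsto (fun k => PowerMethod.powerSeq A p q x₀ k) Filter.atTop (nhds xp) ∧
          Filter.Tendsto (fun k => PowerMethod.vecNorm p (A.mulVec (PowerMethod.powerSeq A p q x₀ k)))
            Filter.atTop (nhds (PowerMethod.matNorm A q p))) ∧
    (q < p → ∃ A : Matrix (Fin 2) (Fin 2) ℝ, (∀ i j, 0 < A i j) ∧ A.det ≠ 0 ∧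
      (A.transpose * A).IsIrreducible ∧ PowerMethod.tau A p q < 1) := by
  refine ⟨fun m n A hn hA hirr hτ => ?_,
    fun _ => PowerMethod.exists_pos_fin_two_tau_lt_one hp hq⟩
  have hcol := PowerMethod.exists_pos_col_of_irreducible hA hirr
  obtain ⟨x, hx, hx1, hmax⟩ := PowerMethod.exists_nonneg_maximizer hn hA hp hq
  have hx0 := PowerMethod.ne_zero_of_vecNorm_eq_one hq hx1
  have hfix := PowerMethod.powerStep_eq_self_of_maximizer hA hcol hp hq hx hx1 hmax
  have hpos := PowerMethod.pos_of_powerStep_eq_self hA hirr hp hq hx hx0 hfix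
  have hgreatest := PowerMethod.isGreatest_normQuotients hq hx1 hmax
  have hnorm : PowerMethod.vecNorm p (A.mulVec x) = PowerMethod.matNorm A q p :=
    hgreatest.csSup_eq.symm
  rw [hnorm] at hgreatest
  refine ⟨hgreatest, x, hpos, hx1, hnorm, fun x₀ hx₀ => ?_⟩
  have hlim := PowerMethod.tendsto_powerSeq hn hA hcol hp hq hτ hx₀ hpos hx1 hfix
  refine ⟨hlim, ?_⟩
  rw [← hnorm]
  exact ((PowerMethod.continuous_vecNorm_mulVec hp).tendsto x).comp hlim
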